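/- A paratopological group is a group with a topology for which multiplication is jointly continuous; it is regular if it is a $T_1$-space in which every neighbourhood of a point contains the closure of a neighbourhood of that point. A paratopological group $G$ is simply $sm$-factorizable if for every cozero set $U\subseteq G$ there is a continuous homomorphism $\pi$ of $G$ onto a separable metrizable paratopological group $H$ with $\pi^{-1}(\pi(U))=U$. For a paratopological group $G$ with topology $\tau$, the associated topological group $G^*$ is the group $G$ with the topology $\tau\vee\tau^{-1}$, where $\tau^{-1}=\{U^{-1}:U\in\tau\}$. The index of narrowness $ib(G)$ is the least cardinal $\kappa\ge\omega$ such that for every open neighbourhood $U$ of the identity there is $A\subseteq G$ with $AU=UA=G$ and $|A|\le\kappa$. Let $c(X)$ be the cellularity of a space $X$ (the supremum of the cardinalities of families of pairwise disjoint nonempty open sets, or $\omega$ if that is larger), and let $\mathfrak c=2^\omega$. For a Tychonoff space $X$, let $\upsilon X$ (the Hewitt-Nachbin realcompactification) and $\mu X$ (the Dieudonné completion) be the smallest realcompact and the smallest Dieudonné complete subspace, respectively, of the Stone-Čech compactification $\beta X$ containing $X$. Let $G$ be a regular simply $sm$-factorizable paratopological group. Then: 1. $ib(G^*)\le\mathfrak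 c$; 2. $c(G)\le c(G^*)\le 2^{\mathfrak c}$; 3. $G$ is Tychonoff, and $\mu G=\upsilon G$ as subspaces of $\beta G$; 4. there is a group operation on $\mu G$ extending that of $G$ which makes the space $\mu G$ a simply $sm$-factorizable paratopological group containing $G$ as a dense topological subgroup. -/

import Mathlib

open Set Topology Cardinal
open scoped Pointwise

universe u

/-- A cozero set: the set where some continuous real-valued function does not vanish. -/
def IsCozeroSet {X : Type u} [TopologicalSpace X] (U : Set X) : Prop :=
  ∃ f : X → ℝ, Continuous f ∧ U = {x | f x ≠ 0}

/-- A paratopological group (`ContinuousMul`: multiplication is jointly continuous) is simply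
sm-factorizable if every cozero set is the full preimage of its image under some continuous
homomorphism onto a separable metrizable paratopological group. Since `H` is an image of `G`,
nothing is lost by taking it in the universe of `G`. -/
def IsSimplySmFactorizable (G : Type u) [Group G] [TopologicalSpace G] : Prop :=
  ∀ U : Set G, IsCozeroSet U →
    ∃ (H : Type u) (_ : Group H) (_ : TopologicalSpace H) (_ : ContinuousMul H)
      (_ : TopologicalSpace.SeparableSpace H) (_ : TopologicalSpace.MetrizableSpace H)
      (p : G →* H), Continuous p ∧ Function.Surjective p ∧ p ⁻¹' (p '' U) = U

/-- The group `G*` associated to a paratopological group `G`: the same group, with the upper bound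
of the topology of `G` and the conjugate topology. -/
def AssociatedGroup (G : Type u) : Type u := G

instance AssociatedGroup.instGroup (G : Type u) [Group G] : Group (AssociatedGroup G) :=
  inferInstanceAs (Group G)

/-- The topology `τ ∨ τ⁻¹`, where `τ⁻¹ = {U⁻¹ : U ∈ τ}`. In Mathlib's order on topologies the
coarsest topology finer than both is the infimum. -/
instance AssociatedGroup.instTopologicalSpace (G : Type u) [Group G] [t : TopologicalSpace G] :
    TopologicalSpace (AssociatedGroup G) :=
  t ⊓ t.induced (fun x : G => x⁻¹)

/-- `G*` is indeed a topological group. -/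
instance AssociatedGroup.instIsTopologicalGroup (G : Type u) [Group G] [t : TopologicalSpace G]
    [ContinuousMul G] : IsTopologicalGroup (AssociatedGroup G) := by
  have h1 : @Continuous (AssociatedGroup G) G _ t (fun x => x) :=
    continuous_id_iff_le.2 inf_le_left
  have h2 : @Continuous (AssociatedGroup G) G _ t (fun x : G => x⁻¹) :=
    continuous_iff_le_induced.2 inf_le_right
  have key : ∀ {Y : Type u} [TopologicalSpace Y] (f : Y → G), @Continuous Y G _ t f →
      @Continuous Y G _ t (fun y => (f y)⁻¹) → @Continuous Y (AssociatedGroup G) _ _ f :=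
    fun {Y} _ f hf hf' => continuous_iff_coinduced_le.2
      (le_inf (continuous_iff_coinduced_le.1 hf)
        (continuous_iff_coinduced_le.1 (continuous_induced_rng.2 hf')))
  refine { continuous_mul := key _ ?_ ?_, continuous_inv := key _ h2 ?_ }
  · exact (h1.comp continuous_fst).mul (h1.comp continuous_snd)
  · exact ((h2.comp continuous_snd).mul (h2.comp continuous_fst)).congr
      fun x => (mul_inv_rev (G := G) x.1 x.2).symm
  · exact h1.congr fun x => (inv_inv (G := G) x).symm

/-- The index of narrowness `ib(G)`. -/
noncomputable def narrownessIndex (G : Type u) [Group G] [TopologicalSpace G] : Cardinal.{u} :=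
  sInf {κ | ℵ₀ ≤ κ ∧ ∀ U : Set G, IsOpen U → 1 ∈ U →
    ∃ A : Set G, A * U = Set.univ ∧ U * A = Set.univ ∧ #A ≤ κ}

/-- A cellular family: pairwise disjoint nonempty open sets. -/
def IsCellularFamily {X : Type u} [TopologicalSpace X] (F : Set (Set X)) : Prop :=
  (∀ U ∈ F, IsOpen U ∧ U.Nonempty) ∧ F.PairwiseDisjoint id

/-- The cellularity `c(X)` (infinite by convention, as all cardinal functions). -/
noncomputable def cellularity (X : Type u) [TopologicalSpace X] : Cardinal.{u} :=
  max ℵ₀ (⨆ F : {F : Set (Set X) // IsCellularFamily F}, #F.1)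

/-- A realcompact space: homeomorphic to a closed subspace of a power of the real line. -/
def IsRealcompact (X : Type u) [TopologicalSpace X] : Prop :=
  ∃ (ι : Type u) (e : X → (ι → ℝ)), IsClosedEmbedding e

/-- A Dieudonné complete space: a `T₀` (hence Tychonoff) space whose topology is induced by a
complete uniformity. -/
def IsDieudonneComplete (X : Type u) [t : TopologicalSpace X] : Prop :=
  T0Space X ∧ ∃ s : UniformSpace X, s.toTopologicalSpace = t ∧ @CompleteSpace X s

/-- The Hewitt-Nachbin realcompactification `υX` of a Tychonoff space `X`: the smallest realcompact
subspace of the Stone-Čech compactification that contains `X`. -/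
def hewittNachbin (X : Type u) [TopologicalSpace X] : Set (StoneCech X) :=
  ⋂₀ {Y | range (stoneCechUnit : X → StoneCech X) ⊆ Y ∧ IsRealcompact Y}

/-- The Dieudonné completion `μX` of a Tychonoff space `X`: the smallest Dieudonné complete
subspace of the Stone-Čech compactification that contains `X`. -/
def dieudonneCompletion (X : Type u) [TopologicalSpace X] : Set (StoneCech X) :=
  ⋂₀ {Y | range (stoneCechUnit : X → StoneCech X) ⊆ Y ∧ IsDieudonneComplete Y}

/-! Everything is reduced to kernels `N` of continuous homomorphisms to second countable metrizable
paratopological groups (`IsSmKernel`). By factorizability, every continuous real function on `G` is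
constant on the cosets of such a kernel (`IsSimplySmFactorizable.exists_smKernel`). Kernels are
stable under countable intersections, have index at most `𝔠`, and, as `G` is completely regular, lie
in arbitrarily small neighbourhoods of 1, even in `G*`. Coset representatives then bound `ib(G*)`. A
disjoint open family in `G*` shrinks to disjoint cosets, and a Ramsey argument with `𝔠` colours
bounds the number of these by `2 ^ 𝔠`.

Both completions are identified with `realHull G`, the points of `βG` at which no continuous real
function on `βG` without zeros on `G` vanishes. This set is realcompact. Conversely, a Dieudonné
complete `Y` between `G` and `βG` contains it: the zero set filter of a hull point is countably
complete and Cauchy in `Y`, because disjoint open families have nonmeasurable size.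

A hull point picks one coset of each kernel, which makes the hull a subgroup of the product of the
quotients `G ⧸ N`. Continuity questions about its multiplication descend to coset representatives in
`G`. -/

open Filter

/-! ### Complete regularity of regular paratopological groups. -/

section CompletelyRegular

variable {G : Type u} [Group G] [TopologicalSpace G] [ContinuousMul G]

theorem closure_mul_subset_closure_mul (A V : Set G) : closure A * V ⊆ closure (A * V) := by
  rintro _ ⟨a, ha, v, hv, rfl⟩
  exact map_mem_closure (f := fun x => x * v) (continuous_mul_const v) ha
    fun b hb => Set.mul_mem_mul hb hv

/-- In a paratopological group the closure of `A` lies in the interior of the closure of `A * V`. -/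
theorem closure_subset_interior_closure_mul (A : Set G) {V : Set G} (hV : IsOpen V)
    (h1 : (1 : G) ∈ V) : closure A ⊆ interior (closure (A * V)) :=
  (subset_mul_left _ h1).trans
    (interior_maximal (closure_mul_subset_closure_mul A V) hV.mul_left)

/-- Pairs of a closed set and a neighbourhood of it that is uniform on the right. -/
def IsRightThickening (c u : Set G) : Prop := ∃ W ∈ 𝓝 (1 : G), closure (c * W) ⊆ u

/-- This is the interpolation step of Urysohn's construction. With `V * V ⊆ W`, the interior of the
closure of `c * V` uses up one factor `V` and leaves the other as room inside `u`. -/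
theorem IsRightThickening.exists_between {c u : Set G} (hcl : IsClosed c)
    (h : IsRightThickening c u) :
    ∃ v : Set G, IsOpen v ∧ c ⊆ v ∧ closure v ⊆ u ∧
      IsRightThickening c v ∧ IsRightThickening (closure v) u := by
  obtain ⟨W, hW, hWu⟩ := h
  obtain ⟨V, hV, hV1, hVW⟩ := exists_open_nhds_one_mul_subset hW
  obtain ⟨V', hV', hV'1, hVV'⟩ := exists_open_nhds_one_mul_subset (hV.mem_nhds hV1)
  have hcv : closure (interior (closure (c * V))) ⊆ closure (c * V) :=
    closure_minimal interior_subset isClosed_closure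
  have hVW' : V ⊆ W := (subset_mul_left V hV1).trans hVW
  refine ⟨interior (closure (c * V)), isOpen_interior, ?_, ?_, ?_, ?_⟩
  · rw [← hcl.closure_eq]
    simpa [hcl.closure_eq] using closure_subset_interior_closure_mul c hV hV1
  · exact hcv.trans ((closure_mono (mul_subset_mul_left hVW')).trans hWu)
  · refine ⟨V', hV'.mem_nhds hV'1, (closure_subset_interior_closure_mul _ hV' hV'1).trans ?_⟩
    rw [mul_assoc]
    exact interior_mono (closure_mono (mul_subset_mul_left hVV'))
  · refine ⟨V, hV.mem_nhds hV1, (closure_minimal ?_ isClosed_closure).trans hWu⟩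
    refine (mul_subset_mul_right hcv).trans ((closure_mul_subset_closure_mul _ _).trans ?_)
    rw [mul_assoc]
    exact closure_mono (mul_subset_mul_left hVW)

/-- Regular paratopological groups are completely regular (Banakh and Ravsky). -/
theorem t35Space_of_t3Space [T3Space G] : T35Space G where
  completely_regular x K hK hx := by
    obtain ⟨C, hC, hCc, hCK⟩ := exists_mem_nhds_isClosed_subset (hK.isOpen_compl.mem_nhds hx)
    have hW : x⁻¹ • C ∈ 𝓝 (1 : G) := by
      have : (fun y => x * y) ⁻¹' C ∈ 𝓝 (1 : G) :=
        (continuous_const_mul x).continuousAt.preimage_mem_nhds (by simpa using hC)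
      simpa [← preimage_smul_inv] using this
    have hxC : closure ({x} * (x⁻¹ • C)) ⊆ Kᶜ := by
      rwa [← smul_eq_mul, singleton_smul, smul_inv_smul, hCc.closure_eq]
    let c : Urysohns.CU (IsRightThickening (G := G)) :=
    { C := {x}
      U := Kᶜ
      closed_C := isClosed_singleton
      open_U := hK.isOpen_compl
      subset := by simpa using hx
      hP := fun hc h _ _ => h.exists_between hc
      P_C_U := ⟨_, hW, hxC⟩ }
    exact ⟨fun y => ⟨c.lim y, c.lim_mem_Icc y⟩, c.continuous_lim.subtype_mk c.lim_mem_Icc,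
      Subtype.ext (c.lim_of_mem_C x rfl), fun y hy =>
        Subtype.ext (c.lim_of_notMem_U y (not_not_intro hy))⟩

end CompletelyRegular

/-! ### Zero set filters and the realcompact hull. -/

section ZeroSets

/-- A countable intersection of zero sets is a zero set. -/
theorem exists_continuousMap_zero_iff_forall {Y : Type*} [TopologicalSpace Y] (g : ℕ → C(Y, ℝ)) :
    ∃ h : C(Y, ℝ), ∀ y, h y = 0 ↔ ∀ n, g n y = 0 := by
  -- Truncation at 1 and summable weights make the series converge uniformly; its terms are
  -- nonnegative, so it vanishes only where all of them do.
  have hb : ∀ n y, ‖1 / 2 / 2 ^ n * min |g n y| 1‖ ≤ 1 / 2 / 2 ^ n := fun n y => by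
    have h0 : (0 : ℝ) ≤ min |g n y| 1 := le_min (abs_nonneg _) zero_le_one
    rw [Real.norm_of_nonneg (by positivity)]
    exact mul_le_of_le_one_right (by positivity) (min_le_right _ _)
  have hs : ∀ y, Summable fun n => 1 / 2 / 2 ^ n * min |g n y| 1 := fun y =>
    (summable_geometric_two' 1).of_norm_bounded fun n => hb n y
  refine ⟨⟨fun y => ∑' n, 1 / 2 / 2 ^ n * min |g n y| 1,
    continuous_tsum (fun n => by fun_prop) (summable_geometric_two' 1) hb⟩, fun y => ?_⟩
  have h0 : ∀ n, 0 ≤ 1 / 2 / 2 ^ n * min |g n y| 1 := fun n =>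
    mul_nonneg (by positivity) (le_min (abs_nonneg _) zero_le_one)
  change ∑' n, 1 / 2 / 2 ^ n * min |g n y| 1 = 0 ↔ _
  rw [← (hs y).hasSum_iff, hasSum_zero_iff_of_nonneg h0, funext_iff]
  refine forall_congr' fun n => ?_
  rw [Pi.zero_apply, mul_eq_zero, or_iff_right (by positivity)]
  refine ⟨fun h => ?_, fun h => by simp [h]⟩
  rcases min_choice |g n y| 1 with h' | h' <;> rw [h'] at h
  · simpa using h
  · norm_num at h

variable {X : Type u} [TopologicalSpace X]

/-- The countably complete filter of traces on `X` of the zero sets of `βX` through `z`. -/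
def zeroSetFilter (z : StoneCech X) : Filter X :=
  Filter.ofCountableInter
    {A | ∃ g : C(StoneCech X, ℝ), g z = 0 ∧ ∀ x, g (stoneCechUnit x) = 0 → x ∈ A}
    (fun S hS hSA => by
      rcases S.eq_empty_or_nonempty with rfl | hne
      · exact ⟨0, rfl, by simp⟩
      obtain ⟨A, rfl⟩ := hS.exists_eq_range hne
      choose g hgz hgA using fun n => hSA ⟨n, rfl⟩
      obtain ⟨h, hh⟩ := exists_continuousMap_zero_iff_forall g
      refine ⟨h, (hh z).2 hgz, fun x hx => ?_⟩
      rintro _ ⟨n, rfl⟩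
      exact hgA n x ((hh _).1 hx n))
    (fun A B ⟨g, hgz, hgA⟩ hAB => ⟨g, hgz, fun x hx => hAB (hgA x hx)⟩)

instance (z : StoneCech X) : CountableInterFilter (zeroSetFilter z) :=
  countableInter_ofCountableInter ..

theorem mem_zeroSetFilter {z : StoneCech X} {A : Set X} : A ∈ zeroSetFilter z ↔
    ∃ g : C(StoneCech X, ℝ), g z = 0 ∧ ∀ x, g (stoneCechUnit x) = 0 → x ∈ A := Iff.rfl

theorem eventually_zeroSetFilter_eq (g : C(StoneCech X, ℝ)) (z : StoneCech X) :
    ∀ᶠ x in zeroSetFilter z, g (stoneCechUnit x) = g z :=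
  ⟨g - ContinuousMap.const _ (g z), by simp, fun x hx => by simpa [sub_eq_zero] using hx⟩

theorem tendsto_zeroSetFilter (z : StoneCech X) :
    Tendsto stoneCechUnit (zeroSetFilter z) (𝓝 z) := by
  refine (nhds_basis_opens z).tendsto_right_iff.2 fun U ⟨hzU, hU⟩ => ?_
  obtain ⟨f, hf, h0, h1⟩ := CompletelyRegularSpace.completely_regular_isOpen z U hU hzU
  refine ⟨⟨fun y => f y, by fun_prop⟩, by simp [h0], fun x hx => ?_⟩
  by_contra hxU
  have hx1 := h1 hxU
  simp_all

theorem exists_extension_of_mem_Icc {f : X → ℝ} (hf : Continuous f) {a b : ℝ}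
    (hab : ∀ x, f x ∈ Icc a b) : ∃ g : C(StoneCech X, ℝ), ∀ x, g (stoneCechUnit x) = f x := by
  have hc : Continuous fun x => (⟨f x, hab x⟩ : Icc a b) := hf.subtype_mk hab
  exact ⟨⟨fun y => (stoneCechExtend hc y).1,
    continuous_subtype_val.comp (continuous_stoneCechExtend hc)⟩, fun x => by simp⟩

/-- The set of points of `βX` whose zero set neighbourhoods all meet `X`. -/
def realHull (X : Type u) [TopologicalSpace X] : Set (StoneCech X) :=
  {z | (zeroSetFilter z).NeBot}

instance (z : realHull X) : (zeroSetFilter (z : StoneCech X)).NeBot := z.2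

theorem pure_le_zeroSetFilter (x : X) : pure x ≤ zeroSetFilter (stoneCechUnit x) :=
  fun _ ⟨_, hg, hA⟩ => hA x hg

theorem stoneCechUnit_mem_realHull (x : X) : stoneCechUnit x ∈ realHull X :=
  neBot_of_le (pure_le_zeroSetFilter x)

theorem range_subset_realHull : range (stoneCechUnit : X → StoneCech X) ⊆ realHull X :=
  range_subset_iff.2 stoneCechUnit_mem_realHull

/-- The canonical map into the hull. -/
def hullUnit (x : X) : realHull X := ⟨stoneCechUnit x, stoneCechUnit_mem_realHull x⟩

theorem continuous_hullUnit : Continuous (hullUnit : X → realHull X) :=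
  continuous_stoneCechUnit.subtype_mk _

theorem tendsto_hullUnit (z : realHull X) :
    Tendsto hullUnit (zeroSetFilter (z : StoneCech X)) (𝓝 z) :=
  tendsto_subtype_rng.2 (tendsto_zeroSetFilter _)

/-- The bounded function `arctan ∘ f` extends to `βX`, and the level set of the extension through
`z` is a zero set; injectivity of `arctan` returns to `f`. -/
theorem exists_eventually_eq (z : realHull X) {f : X → ℝ} (hf : Continuous f) :
    ∃ c, ∀ᶠ x in zeroSetFilter (z : StoneCech X), f x = c := by
  obtain ⟨g, hg⟩ := exists_extension_of_mem_Icc (Real.continuous_arctan.comp hf)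
    (a := -(Real.pi / 2)) (b := Real.pi / 2)
    fun x => ⟨(Real.arctan_mem_Ioo _).1.le, (Real.arctan_mem_Ioo _).2.le⟩
  have h := eventually_zeroSetFilter_eq g (z : StoneCech X)
  obtain ⟨x₀, hx₀⟩ := h.exists
  refine ⟨f x₀, h.mono fun x hx => Real.arctan_injective ?_⟩
  rw [hg] at hx hx₀
  exact hx.trans hx₀.symm

theorem eventually_eq_apply (z : realHull X) {u : realHull X → ℝ} (hu : Continuous u) :
    ∀ᶠ x in zeroSetFilter (z : StoneCech X), u (hullUnit x) = u z := by
  obtain ⟨c, hc⟩ := exists_eventually_eq z (hu.comp continuous_hullUnit)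
  have h1 : Tendsto (u ∘ hullUnit) (zeroSetFilter (z : StoneCech X)) (𝓝 c) :=
    tendsto_const_nhds.congr' (hc.mono fun x hx => hx.symm)
  have h2 := (hu.tendsto z).comp (tendsto_hullUnit z)
  rw [tendsto_nhds_unique h2 h1]
  exact hc

theorem exists_nonvanishing_of_notMem_realHull {z : StoneCech X} (hz : z ∉ realHull X) :
    ∃ g : C(StoneCech X, ℝ), g z = 0 ∧ ∀ x, g (stoneCechUnit x) ≠ 0 := by
  obtain ⟨g, hgz, hg⟩ := mem_zeroSetFilter.1 (empty_mem_iff_bot.2 (not_neBot.1 hz))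
  exact ⟨g, hgz, hg⟩

theorem apply_ne_zero_of_mem_realHull {z : StoneCech X} (hz : z ∈ realHull X)
    {g : C(StoneCech X, ℝ)} (hg : ∀ x, g (stoneCechUnit x) ≠ 0) : g z ≠ 0 := fun h => by
  have : (zeroSetFilter z).NeBot := hz
  obtain ⟨x, hx⟩ := (eventually_zeroSetFilter_eq g z).exists
  exact hg x (hx.trans h)

theorem isClosedEmbedding_eval_stoneCech :
    IsClosedEmbedding fun (z : StoneCech X) (f : C(StoneCech X, ℝ)) => f z := by
  refine Continuous.isClosedEmbedding (continuous_pi fun f => f.continuous) fun z w h => ?_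
  by_contra hne
  obtain ⟨f, hf, h0, h1⟩ := CompletelyRegularSpace.completely_regular_isOpen z {w}ᶜ
    isOpen_compl_singleton hne
  have h2 : (f z : ℝ) = f w := congr_fun h ⟨fun y => f y, by fun_prop⟩
  have h3 : f w = 1 := h1 (by simp)
  simp [h0, h3] at h2

theorem tendsto_nhds_realHull_iff {α : Type*} {F : α → realHull X} {l : Filter α}
    {z : realHull X} : Tendsto F l (𝓝 z) ↔
      ∀ g : C(StoneCech X, ℝ), Tendsto (fun a => g (F a)) l (𝓝 (g z)) := by
  rw [(isClosedEmbedding_eval_stoneCech.isInducing.comp IsInducing.subtypeVal).tendsto_nhds_iff,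
    tendsto_pi_nhds]
  rfl

/-- To the evaluations embedding `βX` are added coordinates `1 / g` for each `g` without zeros on
`X`. The closed conditions `(1 / g) * g = 1` exclude exactly the points outside the hull. -/
theorem isRealcompact_realHull : IsRealcompact (realHull X) := by
  let Φ : StoneCech X → (C(StoneCech X, ℝ) → ℝ) := fun z f => f z
  have hΦ : IsClosedEmbedding Φ := isClosedEmbedding_eval_stoneCech
  let ι := C(StoneCech X, ℝ) ⊕ {g : C(StoneCech X, ℝ) // ∀ x, g (stoneCechUnit x) ≠ 0}
  let e : realHull X → (ι → ℝ) := fun z => Sum.elim (fun f => f z) (fun g => (g.1 z)⁻¹)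
  have hec : Continuous e := continuous_pi fun i => by
    rcases i with f | g
    · exact f.continuous.comp continuous_subtype_val
    · exact (g.1.continuous.comp continuous_subtype_val).inv₀
        fun z => apply_ne_zero_of_mem_realHull z.2 g.2
  have hr : Continuous fun (w : ι → ℝ) (f : C(StoneCech X, ℝ)) => w (Sum.inl f) :=
    continuous_pi fun f => continuous_apply _
  have hee : IsEmbedding e :=
    IsEmbedding.of_comp hec hr (hΦ.isEmbedding.comp IsEmbedding.subtypeVal)
  refine ⟨ι, e, hee, ?_⟩
  have : range e = (fun (w : ι → ℝ) (f : C(StoneCech X, ℝ)) => w (Sum.inl f)) ⁻¹' range Φ ∩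
      ⋂ g : {g : C(StoneCech X, ℝ) // ∀ x, g (stoneCechUnit x) ≠ 0},
        {w | w (Sum.inr g) * w (Sum.inl g.1) = 1} := by
    ext w
    constructor
    · rintro ⟨z, rfl⟩
      exact ⟨⟨z, rfl⟩, mem_iInter.2 fun g =>
        inv_mul_cancel₀ (apply_ne_zero_of_mem_realHull z.2 g.2)⟩
    · rintro ⟨⟨z, hz⟩, hw⟩
      rw [mem_iInter] at hw
      have hwz : ∀ f, w (Sum.inl f) = f z := fun f => (congr_fun hz f).symm
      have hzX : z ∈ realHull X := by
        by_contra hz'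
        obtain ⟨g, hgz, hg⟩ := exists_nonvanishing_of_notMem_realHull hz'
        have := hw ⟨g, hg⟩
        simp [hwz, hgz] at this
      refine ⟨⟨z, hzX⟩, funext fun i => ?_⟩
      rcases i with f | g
      · exact (hwz f).symm
      · have := hw g
        simp only [hwz, mem_ofPred_eq] at this
        exact (eq_inv_of_mul_eq_one_left this).symm
  rw [this]
  exact (hΦ.isClosed_range.preimage hr).inter (isClosed_iInter fun g =>
    isClosed_eq (by fun_prop) continuous_const)

theorem IsRealcompact.isDieudonneComplete {Y : Type u} [t : TopologicalSpace Y]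
    (h : IsRealcompact Y) : IsDieudonneComplete Y := by
  obtain ⟨ι, e, he⟩ := h
  refine ⟨he.isEmbedding.t0Space, UniformSpace.comap e inferInstance,
    he.isInducing.eq_induced.symm, ?_⟩
  let _ := UniformSpace.comap e inferInstance
  have hu : IsUniformInducing e := ⟨rfl⟩
  exact (completeSpace_iff_isComplete_range hu).2 he.isClosed_range.isComplete

end ZeroSets

/-! ### Nonmeasurable cardinals up to `2 ^ 𝔠`. -/

section Nonmeasurable

/-- Every countably complete ultrafilter on `ι` is principal. -/
def IsNonmeasurable (ι : Type*) : Prop :=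
  ∀ F : Filter ι, F.NeBot → CountableInterFilter F → (∀ J : Set ι, J ∈ F ∨ Jᶜ ∈ F) →
    ∃ a, {a} ∈ F

theorem isNonmeasurable_nat : IsNonmeasurable ℕ := by
  intro F _ _ hF
  by_contra! h
  have h' : ∀ᶠ x in F, ∀ n : ℕ, x ≠ n :=
    eventually_countable_forall.2 fun n => (hF {n}).resolve_left (h n)
  obtain ⟨x, hx⟩ := h'.exists
  exact hx x rfl

/-- Deciding each `j ∈ e x` along `F` gives a limit set `b`. If `e x ≠ b` for `F`-almost all `x`,
choosing a coordinate `T x` of disagreement pushes `F` to a filter concentrated at one `j`; but at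
`j` almost all `e x` agree with `b`. -/
theorem IsNonmeasurable.of_injective {κ ι : Type*} (hκ : IsNonmeasurable κ) {e : ι → Set κ}
    (he : Function.Injective e) : IsNonmeasurable ι := by
  intro F _ _ hF
  let b : Set κ := {j | ∀ᶠ x in F, j ∈ e x}
  have hb : ∀ j, ∀ᶠ x in F, (j ∈ e x ↔ j ∈ b) := fun j => by
    by_cases hj : j ∈ b
    · exact Eventually.mono hj fun x hx => iff_of_true hx hj
    · have h : ∀ᶠ x in F, ¬j ∈ e x := (hF {x | j ∈ e x}).resolve_left hj
      exact h.mono fun x hx => iff_of_false hx hj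
  rcases hF {x | e x = b} with h | h
  · obtain ⟨a, ha⟩ := Filter.nonempty_of_mem h
    exact ⟨a, mem_of_superset h fun x hx => he (hx.trans ha.symm)⟩
  have hd : ∀ x, e x ≠ b → ∃ j, ¬(j ∈ e x ↔ j ∈ b) := fun x hx => by
    by_contra! h'
    exact hx (Set.ext h')
  obtain ⟨x₀, hx₀⟩ := Filter.nonempty_of_mem h
  have : Nonempty κ := ⟨(hd x₀ hx₀).choose⟩
  choose! T hT using hd
  have hmap : ∀ J : Set κ, J ∈ F.map T ∨ Jᶜ ∈ F.map T := fun J => hF (T ⁻¹' J)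
  obtain ⟨j, hj⟩ := hκ (F.map T) inferInstance inferInstance hmap
  have hj' : ∀ᶠ x in F, T x = j := hj
  obtain ⟨x, hxT, hxb, hxj⟩ := (hj'.and (Eventually.and h (hb j))).exists
  exact (hT x hxb (hxT ▸ hxj)).elim

theorem isNonmeasurable_of_mk_le {ι : Type u} (h : #ι ≤ 2 ^ (𝔠 : Cardinal.{u})) :
    IsNonmeasurable ι := by
  have h1 : IsNonmeasurable (Set ℕ) := isNonmeasurable_nat.of_injective Function.injective_id
  have h2 : lift.{0} #ι ≤ lift.{u} #(Set (Set ℕ)) := by simpa using h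
  obtain ⟨e⟩ := lift_mk_le'.1 h2
  exact h1.of_injective e.injective

end Nonmeasurable

/-! ### Uniformly continuous pseudometrics. -/

section UniformSpace

open Uniformity SetRel

/-- Every entourage contains a ball of a uniformly continuous pseudometric. -/
theorem exists_pseudoMetricSpace_of_mem_uniformity {Y : Type*} [UniformSpace Y]
    {V : Set (Y × Y)} (hV : V ∈ 𝓤 Y) :
    ∃ m : PseudoMetricSpace Y, ‹UniformSpace Y› ≤ m.toUniformSpace ∧
      ∃ ε > 0, ∀ x y : Y, m.dist x y < ε → (x, y) ∈ V := by
  -- Iterated square roots of a symmetric entourage generate a coarser, countably generated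
  -- uniformity, which is pseudometrizable.
  have hstep : ∀ W : {W : SetRel Y Y // W ∈ 𝓤 Y ∧ W.IsSymm},
      ∃ W' : {W : SetRel Y Y // W ∈ 𝓤 Y ∧ W.IsSymm}, W'.1 ○ W'.1 ⊆ W.1 := fun W => by
    obtain ⟨t, ht, hts, htW⟩ := comp_symm_mem_uniformity_sets W.2.1
    exact ⟨⟨t, ht, hts⟩, htW⟩
  choose next hnext using hstep
  obtain ⟨V₀, hV₀, hV₀s, hV₀V⟩ := comp_symm_mem_uniformity_sets hV
  have h1 : V₀ ⊆ V₀ ○ V₀ := subset_comp_self_of_mem_uniformity hV₀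
  let W : ℕ → {W : SetRel Y Y // W ∈ 𝓤 Y ∧ W.IsSymm} :=
    fun n => Nat.rec ⟨V₀, hV₀, hV₀s⟩ (fun _ W => next W) n
  have hW : ∀ n, (W (n + 1)).1 ○ (W (n + 1)).1 ⊆ (W n).1 := fun n => hnext (W n)
  let c : UniformSpace.Core Y :=
    { uniformity := ⨅ n, 𝓟 (W n).1
      refl := le_iInf fun n => by
        have := refl_le_uniformity.trans (le_principal_iff.2 (W n).2.1)
        exact this
      symm := tendsto_iInf_iInf fun n => tendsto_principal_principal.2 fun p hp =>
        (W n).2.2.symm _ _ hp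
      comp := le_iInf fun n => le_principal_iff.2 (mem_of_superset
        (mem_lift' (mem_iInf_of_mem (n + 1) (mem_principal_self _))) (hW n)) }
  let s : UniformSpace Y := .ofCore c
  have hs : 𝓤[s] = ⨅ n, 𝓟 (W n).1 := rfl
  have : IsCountablyGenerated 𝓤[s] := by rw [hs]; infer_instance
  obtain ⟨m, hm⟩ := @UniformSpace.metrizable_uniformity Y s _
  refine ⟨m, ?_, ?_⟩
  · rw [hm]
    refine UniformSpace.le_def.2 ?_
    rw [hs]
    exact le_iInf fun n => le_principal_iff.2 (W n).2.1
  · have h0 : V ∈ 𝓤[m.toUniformSpace] := by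
      rw [hm, hs]
      exact mem_iInf_of_mem 0 (mem_principal.2 (h1.trans hV₀V))
    obtain ⟨ε, hε, h⟩ := Metric.mem_uniformity_dist.1 h0
    exact ⟨ε, hε, fun x y hxy => h hxy⟩

end UniformSpace

/-! ### Dieudonné completion and realcompactification under small cellularity. -/

section Completeness

variable {X : Type u} [TopologicalSpace X]

/-- All families of pairwise disjoint nonempty open sets have at most `2 ^ 𝔠` members. -/
def HasSmallCellularity (X : Type u) [TopologicalSpace X] : Prop :=
  ∀ (ι : Type u) (U : ι → Set X), (∀ i, IsOpen (U i)) → (∀ i, (U i).Nonempty) →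
    Pairwise (fun i j => Disjoint (U i) (U j)) → #ι ≤ 2 ^ (𝔠 : Cardinal.{u})

/-- The distance to `A` is a continuous real function, hence constant on a member of the filter, and
it decides membership in the thickening. -/
theorem mem_or_compl_mem_preimage_thickening {M : Type*} [PseudoMetricSpace M] {φ : X → M}
    (hφ : Continuous φ) (z : realHull X) (δ : ℝ) (A : Set M) :
    φ ⁻¹' Metric.thickening δ A ∈ zeroSetFilter (z : StoneCech X) ∨
      (φ ⁻¹' Metric.thickening δ A)ᶜ ∈ zeroSetFilter (z : StoneCech X) := by
  rcases A.eq_empty_or_nonempty with rfl | hA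
  -- The empty set is separate because `Metric.infDist` to it is 0 by convention, while its
  -- thickening is empty.
  · simp
  obtain ⟨c, hc⟩ := exists_eventually_eq z ((Metric.continuous_infDist_pt A).comp hφ)
  rcases lt_or_ge c δ with h | h
  · refine .inl (hc.mono fun x hx => ?_)
    exact (Metric.mem_thickening_iff_infDist_lt hA).2 (hx.trans_lt h)
  · refine .inr (hc.mono fun x hx hx' => ?_)
    have := (Metric.mem_thickening_iff_infDist_lt hA).1 hx'
    exact (h.trans_eq hx.symm).not_gt this

/-- The sets of Stone's theorem on the paracompactness of metric spaces. -/
def stoneSet {M : Type*} [PseudoMetricSpace M] (r : M → M → Prop) (ε δ : ℝ) (a : M) : Set M :=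
  {m | dist m a ≤ ε - 3 * δ ∧ ∀ b, r b a → ε ≤ dist m b}

/-- If `a` precedes `b`, points of the first set are within `ε - 3δ` of `a` and points of the second
at least `ε` away from it. The gap `3δ` survives two thickenings by `δ`. -/
theorem disjoint_thickening_stoneSet {M : Type*} [PseudoMetricSpace M] (r : M → M → Prop)
    [IsWellOrder M r] (ε δ : ℝ) {a b : M} (hab : a ≠ b) :
    Disjoint (Metric.thickening δ (stoneSet r ε δ a)) (Metric.thickening δ (stoneSet r ε δ b)) := by
  have key : ∀ a b, r a b → Disjoint (Metric.thickening δ (stoneSet r ε δ a))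
      (Metric.thickening δ (stoneSet r ε δ b)) := fun a b hr => by
    refine disjoint_left.2 fun m hma hmb => ?_
    obtain ⟨x, hx, hmx⟩ := Metric.mem_thickening_iff.1 hma
    obtain ⟨y, hy, hmy⟩ := Metric.mem_thickening_iff.1 hmb
    have h1 := hy.2 a hr
    have h2 := hx.1
    have h3 := dist_triangle4 y m x a
    rw [dist_comm y m] at h3
    have h4 := dist_nonneg (x := m) (y := x)
    linarith
  rcases trichotomous_of r a b with h | h | h
  · exact key a b h
  · exact (hab h).elim
  · exact (key b a h).symm

theorem exists_mem_stoneSet {M : Type*} [PseudoMetricSpace M] (r : M → M → Prop)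
    [IsWellOrder M r] {ε : ℝ} (hε : 0 < ε) (m : M) :
    ∃ (n : ℕ) (a : M), m ∈ stoneSet r ε (1 / (n + 1)) a := by
  obtain ⟨a, ha, hmin⟩ := (IsWellFounded.wf (r := r)).has_min {a | dist m a < ε}
    ⟨m, by simpa using hε⟩
  have ha' : 0 < (ε - dist m a) / 3 := div_pos (sub_pos.2 ha) (by norm_num)
  obtain ⟨n, hn⟩ := exists_nat_one_div_lt ha'
  refine ⟨n, a, ?_, fun b hb => not_lt.1 fun h => hmin b h hb⟩
  linarith

/-- Stone's sets cover `M` by countably many disjoint families, so countable completeness selects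
one level `n`. The filter decides every subunion of that level and so induces a countably complete
ultrafilter on the indices of its nonempty members. There are at most `2 ^ 𝔠` of these, so the
ultrafilter is principal. -/
theorem exists_eventually_dist_lt (hX : HasSmallCellularity X) {M : Type u} [PseudoMetricSpace M]
    {φ : X → M} (hφ : Continuous φ) (z : realHull X) {ε : ℝ} (hε : 0 < ε) :
    ∃ a, ∀ᶠ x in zeroSetFilter (z : StoneCech X), dist (φ x) a < ε := by
  let r : M → M → Prop := WellOrderingRel
  let U : ℕ → M → Set X := fun n a =>
    φ ⁻¹' Metric.thickening (1 / (n + 1)) (stoneSet r ε (1 / (n + 1)) a)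
  -- A union of thickenings of one fixed radius is the thickening of the union.
  have hUn : ∀ (n : ℕ) (J : Set M), (⋃ a ∈ J, U n a) ∈ zeroSetFilter (z : StoneCech X) ∨
      (⋃ a ∈ J, U n a)ᶜ ∈ zeroSetFilter (z : StoneCech X) := fun n J => by
    simpa [U, Metric.thickening_biUnion] using mem_or_compl_mem_preimage_thickening hφ z
      (1 / (n + 1)) (⋃ a ∈ J, stoneSet r ε (1 / (n + 1)) a)
  obtain ⟨n, hn⟩ : ∃ n, ∀ᶠ x in zeroSetFilter (z : StoneCech X), ∃ a, x ∈ U n a := by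
    by_contra! h
    have h' : ∀ᶠ x in zeroSetFilter (z : StoneCech X), ∀ n, ∀ a, x ∉ U n a :=
      eventually_countable_forall.2 fun n => by
        have := hUn n univ
        simp only [mem_univ, iUnion_true] at this
        have h1 := this.resolve_left fun h' => h n <|
          Eventually.mono h' fun x hx => by simpa using mem_iUnion.1 hx
        exact Eventually.mono h1 fun x hx => by simpa using hx
    obtain ⟨x, hx⟩ := h'.exists
    obtain ⟨n, a, ha⟩ := exists_mem_stoneSet r hε (φ x)
    exact hx n a (Metric.self_subset_thickening (by positivity) _ ha)
  have hdisj : ∀ a b, a ≠ b → Disjoint (U n a) (U n b) := fun a b hab =>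
    (disjoint_thickening_stoneSet r ε _ hab).preimage φ
  let I := {a : M // (U n a).Nonempty}
  have hI : IsNonmeasurable I := isNonmeasurable_of_mk_le (hX I (fun a => U n a)
    (fun a => Metric.isOpen_thickening.preimage hφ) (fun a => a.2)
    fun a b hab => hdisj a b fun h => hab (Subtype.ext h))
  have hT : ∀ x, (∃ a, x ∈ U n a) → ∃ a : I, x ∈ U n a := fun x ⟨a, ha⟩ => ⟨⟨a, x, ha⟩, ha⟩
  obtain ⟨x₀, hx₀⟩ := hn.exists
  have : Nonempty I := ⟨(hT x₀ hx₀).choose⟩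
  choose! T hT using hT
  obtain ⟨a, ha⟩ := hI ((zeroSetFilter (z : StoneCech X)).map T) inferInstance inferInstance
    fun J => by
      refine (hUn n ((fun a : I => a.1) '' J)).imp (fun h => ?_) fun h => ?_
      · refine mem_map.2 ?_
        filter_upwards [h] with x hx
        simp only [biUnion_image, mem_iUnion] at hx
        obtain ⟨a, haJ, hxa⟩ := hx
        have hxT := hT x ⟨a, hxa⟩
        have : T x = a := by
          by_contra hne
          exact disjoint_left.1 (hdisj _ _ fun h => hne (Subtype.ext h)) hxT hxa
        exact mem_preimage.2 (this ▸ haJ)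
      · refine mem_map.2 ?_
        filter_upwards [h, hn] with x hx hxn hxJ
        refine hx ?_
        simp only [biUnion_image, mem_iUnion]
        exact ⟨T x, hxJ, hT x hxn⟩
  refine ⟨a, ?_⟩
  have ha' : ∀ᶠ x in zeroSetFilter (z : StoneCech X), T x = a := ha
  filter_upwards [ha', hn] with x hx hxn
  have hxa := hT x hxn
  rw [hx] at hxa
  obtain ⟨y, hy, hxy⟩ := Metric.mem_thickening_iff.1 hxa
  have h1 := hy.1
  have h2 := dist_triangle (φ x) y a
  have h3 : (0 : ℝ) < 1 / (n + 1) := by positivity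
  linarith

/-- The zero set filter of `z` is small for every uniformly continuous pseudometric on `Y`, hence
Cauchy. Its limit in `Y` must be `z`, to which it already converges in `βX`. -/
theorem realHull_subset_of_isDieudonneComplete (hX : HasSmallCellularity X)
    {Y : Set (StoneCech X)} (hXY : range (stoneCechUnit : X → StoneCech X) ⊆ Y)
    (hY : IsDieudonneComplete Y) : realHull X ⊆ Y := by
  obtain ⟨-, s, hs, hcomp⟩ := hY
  intro z hz
  let z' : realHull X := ⟨z, hz⟩
  have hz' : (zeroSetFilter (z' : StoneCech X)).NeBot := hz
  let η : X → Y := fun x => ⟨stoneCechUnit x, hXY ⟨x, rfl⟩⟩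
  have hη : Continuous η := continuous_stoneCechUnit.subtype_mk _
  have hF : Cauchy ((zeroSetFilter (z' : StoneCech X)).map η) := by
    refine ⟨inferInstance, fun V hV => ?_⟩
    obtain ⟨m, hm, ε, hε, hmV⟩ := exists_pseudoMetricSpace_of_mem_uniformity hV
    have hη' : @Continuous X Y _ m.toUniformSpace.toTopologicalSpace η := by
      refine continuous_le_rng ?_ hη
      rw [← hs]
      exact UniformSpace.toTopologicalSpace_mono hm
    obtain ⟨a, ha⟩ := @exists_eventually_dist_lt X _ hX Y m η hη' z' (ε / 2) (half_pos hε)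
    refine mem_of_superset (prod_mem_prod (image_mem_map ha) (image_mem_map ha)) ?_
    rintro ⟨_, _⟩ ⟨⟨x, hx, rfl⟩, ⟨y, hy, rfl⟩⟩
    refine hmV _ _ ?_
    have h1 := m.dist_triangle (η x) a (η y)
    have h2 := m.dist_comm a (η y)
    have h3 : m.dist (η x) a < ε / 2 := hx
    have h4 : m.dist (η y) a < ε / 2 := hy
    linarith
  obtain ⟨y, hy⟩ := hcomp.complete hF
  have hy' : Tendsto η (zeroSetFilter (z' : StoneCech X)) (𝓝 y) := by
    have : Tendsto η (zeroSetFilter (z' : StoneCech X)) (@nhds Y s.toTopologicalSpace y) := hy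
    rwa [hs] at this
  have h1 : Tendsto stoneCechUnit (zeroSetFilter (z' : StoneCech X)) (𝓝 (y : StoneCech X)) :=
    (continuous_subtype_val.tendsto y).comp hy'
  have h2 : z = y := tendsto_nhds_unique (tendsto_zeroSetFilter (z' : StoneCech X)) h1
  exact h2 ▸ y.2

theorem dieudonneCompletion_eq_realHull (hX : HasSmallCellularity X) :
    dieudonneCompletion X = realHull X :=
  Subset.antisymm
    (sInter_subset_of_mem ⟨range_subset_realHull, isRealcompact_realHull.isDieudonneComplete⟩)
    (subset_sInter fun _ hY => realHull_subset_of_isDieudonneComplete hX hY.1 hY.2)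

theorem hewittNachbin_eq_realHull (hX : HasSmallCellularity X) :
    hewittNachbin X = realHull X :=
  Subset.antisymm (sInter_subset_of_mem ⟨range_subset_realHull, isRealcompact_realHull⟩)
    (subset_sInter fun _ hY => realHull_subset_of_isDieudonneComplete hX hY.1
      hY.2.isDieudonneComplete)

end Completeness

/-! ### A partition theorem of Erdős–Rado type. -/

section Ramsey

/-- If a colouring of the pairs of a well-ordered set `I` with colours in `κ` has no monochromatic
triangle, then `I` embeds in `Set (κ × κ)`. -/
theorem exists_injective_of_no_monochromatic_triangle {I κ : Type*} [LinearOrder I]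
    [WellFoundedLT I] (col : I → I → κ)
    (h : ∀ a b c, a < b → b < c → col a b = col a c → col a c ≠ col b c) :
    ∃ D : I → Set (κ × κ), Function.Injective D := by
  -- `P β α` says that `α` is on the branch of `β`: each earlier member `α'` of the branch gives the
  -- pairs `(α', α)` and `(α', β)` the same colour.
  let P : I → I → Prop := fun β => (wellFounded_lt (α := I)).fix
    fun α ih => α < β ∧ ∀ α' (h : α' < α), ih α' h → col α' α = col α' β
  have hP : ∀ β α, P β α ↔ α < β ∧ ∀ α' < α, P β α' → col α' α = col α' β := fun β α => by
    have := (wellFounded_lt (α := I)).fix_eq (C := fun _ => Prop)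
      (fun α ih => α < β ∧ ∀ α' (h : α' < α), ih α' h → col α' α = col α' β) α
    exact this.to_iff
  have hlt : ∀ {β α}, P β α → α < β := fun hα => ((hP _ _).1 hα).1
  -- Without monochromatic triangles, a member `α` of the branch is determined by its colour `col α
  -- β`.
  have hne' : ∀ {β α α'}, P β α' → P β α → α' < α → col α' β ≠ col α β := fun h' hα hl =>
    h _ _ _ hl (hlt hα) (((hP _ _).1 hα).2 _ hl h')
  have hinj : ∀ {β α α'}, P β α' → P β α → col α' β = col α β → α' = α := fun h' hα he => by
    by_contra hne
    rcases lt_or_gt_of_ne hne with hl | hl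
    · exact hne' h' hα hl he
    · exact hne' hα h' hl he.symm
  -- The code of `β` is the well-order that its branch induces on the colours occurring there.
  let D : I → Set (κ × κ) := fun β =>
    {q | ∃ α' α, α' ≤ α ∧ P β α' ∧ P β α ∧ col α' β = q.1 ∧ col α β = q.2}
  have key : ∀ {β γ α}, D β = D γ →
      (∀ δ < α, (P β δ → P γ δ ∧ col δ β = col δ γ) ∧ (P γ δ → P β δ ∧ col δ γ = col δ β)) →
      P β α → P γ α ∧ col α β = col α γ := by
    intro β γ α hD ih hα
    have hmem : (col α β, col α β) ∈ D γ := hD ▸ ⟨α, α, le_rfl, hα, hα, rfl, rfl⟩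
    obtain ⟨-, α', -, -, hα', -, hc⟩ := hmem
    replace hc : col α' γ = col α β := hc
    -- Here `α'` is the member of the branch of `γ` with the colour of `α`. Equality of codes and
    -- the induction hypothesis make the two branches agree below these points, which forces `α =
    -- α'`.
    have hpre : ∀ δ < α', P γ δ → δ < α := by
      intro δ hδ hPδ
      have hmem : (col δ γ, col α' γ) ∈ D β := hD ▸ ⟨δ, α', hδ.le, hPδ, hα', rfl, rfl⟩
      obtain ⟨δ', α'', hle, hδ', hα'', h1, h2⟩ := hmem
      replace h1 : col δ' β = col δ γ := h1
      replace h2 : col α'' β = col α' γ := h2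
      obtain rfl : α'' = α := hinj hα'' hα (h2.trans hc)
      have hl : δ' < α'' := by
        refine lt_of_le_of_ne hle fun he => ?_
        subst he
        exact hne' hPδ hα' hδ (h1.symm.trans h2)
      have h3 := (ih δ' hl).1 hδ'
      have h4 : δ' = δ := hinj h3.1 hPδ (h3.2.symm.trans h1)
      exact h4 ▸ hl
    rcases lt_trichotomy α α' with hl | rfl | hl
    · have : P γ α := (hP _ _).2 ⟨hl.trans (hlt hα'), fun δ hδ hPδ => by
        have h1 := (ih δ hδ).2 hPδ
        rw [((hP _ _).1 hα).2 δ hδ h1.1, h1.2]⟩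
      exact (lt_irrefl _ (hpre α hl this)).elim
    · exact ⟨hα', hc.symm⟩
    · have : P β α' := (hP _ _).2 ⟨hl.trans (hlt hα), fun δ hδ hPδ => by
        have h1 := (ih δ (hδ.trans hl)).1 hPδ
        rw [((hP _ _).1 hα').2 δ hδ h1.1, h1.2]⟩
      exact (hne' this hα hl (((ih α' hl).1 this).2.trans hc)).elim
  have hall : ∀ {β γ}, D β = D γ → ∀ α,
      (P β α → P γ α ∧ col α β = col α γ) ∧ (P γ α → P β α ∧ col α γ = col α β) := by
    intro β γ hD α
    induction α using WellFoundedLT.induction with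
    | ind α ih => exact ⟨key hD ih, key hD.symm fun δ hδ => (ih δ hδ).symm⟩
  have hlast : ∀ {β γ}, D β = D γ → ¬β < γ := by
    intro β γ hD hl
    -- Equal codes give equal branches and colours, so `β` lies on the branch of `γ`, hence on its
    -- own, which is absurd.
    have h1 : P γ β := (hP _ _).2 ⟨hl, fun δ _ hPδ => ((hall hD δ).2 hPδ).2.symm⟩
    exact lt_irrefl _ (hlt ((hall hD β).2 h1).1)
  exact ⟨D, fun β γ hD => le_antisymm (not_lt.1 (hlast hD.symm)) (not_lt.1 (hlast hD))⟩

end Ramsey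

/-! ### Kernels of homomorphisms to separable metrizable groups. -/

section Kernels

theorem isCozeroSet_lt {X : Type u} [TopologicalSpace X] {f : X → ℝ} (hf : Continuous f)
    (a : ℝ) : IsCozeroSet {x | a < f x} :=
  ⟨fun x => max (f x - a) 0, by fun_prop, by ext x; simp⟩

variable {G : Type u} [Group G] [TopologicalSpace G]

/-- Kernels of continuous homomorphisms to separable metrizable paratopological groups. -/
def IsSmKernel (N : Subgroup G) : Prop :=
  ∃ (H : Type u) (_ : Group H) (_ : TopologicalSpace H) (_ : ContinuousMul H)
    (_ : SecondCountableTopology H) (_ : TopologicalSpace.MetrizableSpace H) (p : G →* H),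
    Continuous p ∧ p.ker = N

theorem IsSmKernel.normal {N : Subgroup G} (hN : IsSmKernel N) : N.Normal := by
  obtain ⟨H, _, _, _, _, _, p, -, rfl⟩ := hN
  infer_instance

theorem IsSmKernel.iInf {ι : Type} [Countable ι] {N : ι → Subgroup G}
    (hN : ∀ i, IsSmKernel (N i)) : IsSmKernel (⨅ i, N i) := by
  choose H _ _ _ _ _ p hp hpN using hN
  refine ⟨∀ i, H i, inferInstance, inferInstance, inferInstance, inferInstance, inferInstance,
    MonoidHom.pi p, continuous_pi hp, ?_⟩
  ext x
  simp [MonoidHom.mem_ker, funext_iff, Subgroup.mem_iInf, ← hpN]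

theorem IsSmKernel.inf {N M : Subgroup G} (hN : IsSmKernel N) (hM : IsSmKernel M) :
    IsSmKernel (N ⊓ M) := by
  have h : (⨅ b : Bool, cond b N M) = N ⊓ M := iInf_bool_eq
  rw [← h]
  exact .iInf fun b => by cases b <;> assumption

/-- Distances to a dense sequence separate the points of the metrizable group, so countably many
real functions encode the cosets of `N`. -/
theorem IsSmKernel.exists_continuous {N : Subgroup G} (hN : IsSmKernel N) :
    ∃ f : ℕ → G → ℝ, (∀ n, Continuous (f n)) ∧
      ∀ x y, x⁻¹ * y ∈ N ↔ ∀ n, f n x = f n y := by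
  obtain ⟨H, _, _, _, _, _, p, hp, rfl⟩ := hN
  let _ := TopologicalSpace.metrizableSpaceMetric H
  let d := TopologicalSpace.denseSeq H
  refine ⟨fun n x => dist (p x) (d n), fun n => hp.dist continuous_const, fun x y => ?_⟩
  rw [MonoidHom.mem_ker, map_mul, map_inv, inv_mul_eq_one]
  refine ⟨fun h n => congr_arg (dist · (d n)) h, fun h => ?_⟩
  have : (fun v => dist (p x) v) = fun v => dist (p y) v :=
    Continuous.ext_on (TopologicalSpace.denseRange_denseSeq H) (by fun_prop) (by fun_prop)
      (by rintro _ ⟨n, rfl⟩; exact h n)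
  have h2 := congr_fun this (p x)
  simp only [dist_self] at h2
  exact (dist_eq_zero.1 h2.symm).symm

theorem IsSmKernel.mk_quotient_le {N : Subgroup G} (hN : IsSmKernel N) :
    #(G ⧸ N) ≤ 𝔠 := by
  obtain ⟨f, -, hf⟩ := hN.exists_continuous
  have h : lift.{0} #(G ⧸ N) ≤ lift.{u} #(ℕ → ℝ) := by
    refine lift_mk_le_lift_mk_of_injective (f := fun q : G ⧸ N => fun n => f n q.out) fun q r h => ?_
    rw [← q.out_eq', ← r.out_eq']
    exact QuotientGroup.eq.2 ((hf _ _).2 (congr_fun h))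
  simpa [mk_real] using h

/-- Factorizability applies to the cozero sets `{q < f}` with `q` rational; modulo the intersection
of these countably many kernels, no rational separates two values of `f`. -/
theorem IsSimplySmFactorizable.exists_smKernel (hG : IsSimplySmFactorizable G) {f : G → ℝ}
    (hf : Continuous f) :
    ∃ N : Subgroup G, IsSmKernel N ∧ ∀ x y, x⁻¹ * y ∈ N → f x = f y := by
  have h : ∀ q : ℚ, ∃ N : Subgroup G, IsSmKernel N ∧
      ∀ x y, x⁻¹ * y ∈ N → q < f x → q < f y := fun q => by
    obtain ⟨H, _, _, _, _, _, p, hp, -, hpU⟩ := hG _ (isCozeroSet_lt hf q)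
    let _ := TopologicalSpace.metrizableSpaceMetric H
    have := UniformSpace.secondCountable_of_separable H
    refine ⟨p.ker, ⟨H, _, _, ‹_›, this, ‹_›, p, hp, rfl⟩, fun x y hxy hx => ?_⟩
    rw [MonoidHom.mem_ker, map_mul, map_inv, inv_mul_eq_one] at hxy
    have : y ∈ p ⁻¹' (p '' {x | (q : ℝ) < f x}) := ⟨x, hx, hxy⟩
    rw [hpU] at this
    exact this
  choose N hN hNf using h
  refine ⟨⨅ q, N q, .iInf hN, fun x y hxy => ?_⟩
  have key : ∀ x y, x⁻¹ * y ∈ ⨅ q, N q → f y ≤ f x := fun x y hxy => by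
    by_contra! hlt
    obtain ⟨q, hq1, hq2⟩ := exists_rat_btwn hlt
    have h1 := hNf q y x (by simpa using inv_mem (Subgroup.mem_iInf.1 hxy q)) hq2
    exact h1.not_gt hq1
  exact le_antisymm (key y x (by simpa using inv_mem hxy)) (key x y hxy)

theorem IsSimplySmFactorizable.exists_smKernel_subset [T35Space G] (hG : IsSimplySmFactorizable G)
    {U : Set G} (hU : U ∈ 𝓝 (1 : G)) : ∃ N : Subgroup G, IsSmKernel N ∧ (N : Set G) ⊆ U := by
  obtain ⟨f, hf, h0, h1⟩ := CompletelyRegularSpace.completely_regular_isOpen (1 : G) _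
    isOpen_interior (mem_interior_iff_mem_nhds.2 hU)
  obtain ⟨N, hN, hNf⟩ := hG.exists_smKernel (continuous_subtype_val.comp hf)
  refine ⟨N, hN, fun x hx => interior_subset (by_contra fun hxU => ?_)⟩
  have h2 := hNf 1 x (by simpa using hx)
  have h3 : f x = 1 := h1 hxU
  simp [h0, h3] at h2

theorem mk_le_of_disjoint_cosets {I : Type u} (x : I → G) (N : I → Subgroup G)
    (hN : ∀ i, IsSmKernel (N i))
    (hd : ∀ i j t, (x i)⁻¹ * t ∈ N i → (x j)⁻¹ * t ∈ N j → i = j) :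
    #I ≤ 2 ^ (𝔠 : Cardinal.{u}) := by
  choose f _ hf using fun i => (hN i).exists_continuous
  let F : I → G → ℕ → ℝ := fun i y n => f i n y
  have hF : ∀ i y z, F i y = F i z ↔ y⁻¹ * z ∈ N i := fun i y z => by
    rw [hf]
    exact funext_iff
  obtain ⟨_, _⟩ := exists_wellFoundedLT I
  -- In a monochromatic triangle `a < b < c`, `x b` and `x c` agree modulo `N a`, and `x a` and `x
  -- b` agree modulo `N c`. By normality, `x a * (x b)⁻¹ * x c` then lies in the cosets of both `x
  -- a` and `x c`, contrary to disjointness.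
  obtain ⟨D, hD⟩ := exists_injective_of_no_monochromatic_triangle
    (fun i j : I => (F i (x j), F j (x i))) (by
      intro a b c hab hbc h1 h2
      have h3 := (hF _ _ _).1 (congr_arg Prod.fst h1)
      have h4 := (hF _ _ _).1 (congr_arg Prod.snd h2)
      refine (hab.trans hbc).ne (hd a c (x a * ((x b)⁻¹ * x c)) (by simpa using h3) ?_)
      simpa [mul_assoc] using (hN c).normal.conj_mem _ (inv_mem h4) ((x c)⁻¹ * x b))
  have h : lift.{0} #I ≤ lift.{u} #(Set (((ℕ → ℝ) × (ℕ → ℝ)) × ((ℕ → ℝ) × (ℕ → ℝ)))) :=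
    lift_mk_le_lift_mk_of_injective hD
  simpa [mk_real] using h

end Kernels

/-! ### Narrowness and cellularity of `G*`. -/

section AssociatedGroup

variable {G : Type u} [Group G] [TopologicalSpace G]

theorem IsOpen.associatedGroup {U : Set G} (hU : IsOpen U) :
    IsOpen (X := AssociatedGroup G) U :=
  hU.mono inf_le_left

/-- A subgroup inside `V` also lies inside `V⁻¹`, so kernels are as small in `G*` as in `G`. -/
theorem IsSimplySmFactorizable.exists_smKernel_subset_associatedGroup [T35Space G]
    (hG : IsSimplySmFactorizable G) {U : Set (AssociatedGroup G)}
    (hU : U ∈ 𝓝 (1 : AssociatedGroup G)) :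
    ∃ N : Subgroup G, IsSmKernel N ∧ ∀ x ∈ N, (x : AssociatedGroup G) ∈ U := by
  have h : 𝓝 (1 : AssociatedGroup G) = 𝓝 (1 : G) ⊓ comap (fun x : G => x⁻¹) (𝓝 (1 : G)) := by
    refine (nhds_inf (a := (1 : G))).trans (congrArg (𝓝 (1 : G) ⊓ ·) ?_)
    exact (nhds_induced (fun x : G => x⁻¹) 1).trans (by rw [inv_one])
  rw [h] at hU
  obtain ⟨A, hA, B, ⟨V, hV, hVB⟩, rfl⟩ := hU
  obtain ⟨N, hN, hNV⟩ := hG.exists_smKernel_subset (inter_mem hA hV)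
  exact ⟨N, hN, fun x hx => ⟨(hNV hx).1, hVB (hNV (inv_mem hx)).2⟩⟩

theorem cellularity_le_associatedGroup : cellularity G ≤ cellularity (AssociatedGroup G) := by
  refine max_le_max le_rfl (ciSup_le' fun F => ?_)
  exact le_ciSup (f := fun F : {F : Set (Set (AssociatedGroup G)) // IsCellularFamily F} => #F.1)
    bddAbove_of_small ⟨F.1, fun U hU => ⟨(F.2.1 U hU).1.associatedGroup, (F.2.1 U hU).2⟩, F.2.2⟩

theorem IsSimplySmFactorizable.narrownessIndex_associatedGroup_le [T35Space G]
    (hG : IsSimplySmFactorizable G) : narrownessIndex (AssociatedGroup G) ≤ 𝔠 := by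
  refine csInf_le' ⟨aleph0_le_continuum, fun U hU h1 => ?_⟩
  obtain ⟨N, hN, hNU⟩ := hG.exists_smKernel_subset_associatedGroup (hU.mem_nhds h1)
  have hs : ∀ g : G, ((g : G ⧸ N).out)⁻¹ * g ∈ N := fun g =>
    QuotientGroup.eq.1 (QuotientGroup.out_eq' _)
  refine ⟨range fun q : G ⧸ N => (q.out : G), eq_univ_of_forall fun g => ?_,
    eq_univ_of_forall fun g => ?_, mk_range_le.trans hN.mk_quotient_le⟩
  · exact ⟨_, ⟨(QuotientGroup.mk g : G ⧸ N), rfl⟩, _, hNU _ (hs g), mul_inv_cancel_left (G := G) _ _⟩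
  · refine ⟨_, hNU _ (hN.normal.conj_mem _ (hs g) (QuotientGroup.mk g : G ⧸ N).out), _,
      ⟨(QuotientGroup.mk g : G ⧸ N), rfl⟩, ?_⟩
    change (_ : G) * (_ * _) * _ * _ = g
    rw [mul_assoc, inv_mul_cancel, mul_one]
    exact mul_inv_cancel_left (G := G) _ _

variable [ContinuousMul G]

theorem mk_le_of_disjoint_open_associatedGroup [T35Space G] (hG : IsSimplySmFactorizable G)
    {I : Type u} (U : I → Set (AssociatedGroup G)) (ho : ∀ i, IsOpen (U i))
    (hne : ∀ i, (U i).Nonempty) (hd : Pairwise fun i j => Disjoint (U i) (U j)) :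
    #I ≤ 2 ^ (𝔠 : Cardinal.{u}) := by
  have hne' : ∀ i, ∃ y : G, y ∈ U i := hne
  choose x hx using hne'
  have h : ∀ i, ∃ N : Subgroup G, IsSmKernel N ∧ ∀ y ∈ N, (x i * y : G) ∈ U i := fun i => by
    have h1 : x i * 1 ∈ U i := by simpa using hx i
    exact hG.exists_smKernel_subset_associatedGroup
      ((continuous_const_mul (M := AssociatedGroup G) (x i)).continuousAt.preimage_mem_nhds
        ((ho i).mem_nhds h1))
  choose N hN hNU using h
  refine mk_le_of_disjoint_cosets x N hN fun i j t hi hj => by_contra fun hij => ?_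
  have hti : t ∈ U i := by simpa using hNU i _ hi
  have htj : t ∈ U j := by simpa using hNU j _ hj
  exact Set.disjoint_left.1 (hd hij) hti htj

theorem IsSimplySmFactorizable.hasSmallCellularity [T35Space G] (hG : IsSimplySmFactorizable G) :
    HasSmallCellularity G := fun _ U ho hne hd =>
  mk_le_of_disjoint_open_associatedGroup hG U (fun i => (ho i).associatedGroup) hne hd

theorem IsSimplySmFactorizable.cellularity_associatedGroup_le [T35Space G]
    (hG : IsSimplySmFactorizable G) :
    cellularity (AssociatedGroup G) ≤ 2 ^ (𝔠 : Cardinal.{u}) := by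
  refine max_le (aleph0_le_continuum.trans (cantor _).le) (ciSup_le' fun F => ?_)
  refine mk_le_of_disjoint_open_associatedGroup hG (fun U : F.1 => U.1) (fun U => (F.2.1 _ U.2).1)
    (fun U => (F.2.1 _ U.2).2) fun U V hUV => F.2.2 U.2 V.2 fun h => hUV (Subtype.ext h)

end AssociatedGroup

/-! ### The paratopological group structure on the hull. -/

section HullGroup

variable {G : Type u} [Group G] [TopologicalSpace G]

/-- The kernels of continuous homomorphisms to separable metrizable paratopological groups. -/
abbrev SmKernel (G : Type u) [Group G] [TopologicalSpace G] : Type u :=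
  {N : Subgroup G // IsSmKernel N}

instance (N : SmKernel G) : N.1.Normal := N.2.normal

theorem exists_eventually_mk_eq (z : realHull G) (N : SmKernel G) :
    ∃ c : G ⧸ N.1, ∀ᶠ x : G in zeroSetFilter (z : StoneCech G), (x : G ⧸ N.1) = c := by
  obtain ⟨f, hf, hfN⟩ := N.2.exists_continuous
  choose c hc using fun n => exists_eventually_eq z (hf n)
  have h := eventually_countable_forall.2 hc
  obtain ⟨x₀, hx₀⟩ := h.exists
  refine ⟨x₀, h.mono fun x hx => QuotientGroup.eq.2 ((hfN _ _).2 fun n => ?_)⟩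
  rw [hx, hx₀]

/-- The coset of `N` that belongs to the zero set filter of `z`. -/
noncomputable def hullCoset (z : realHull G) (N : SmKernel G) : G ⧸ N.1 :=
  (exists_eventually_mk_eq z N).choose

theorem eventually_mk_eq_hullCoset (z : realHull G) (N : SmKernel G) :
    ∀ᶠ x : G in zeroSetFilter (z : StoneCech G), (x : G ⧸ N.1) = hullCoset z N :=
  (exists_eventually_mk_eq z N).choose_spec

theorem hullCoset_hullUnit (x : G) (N : SmKernel G) : hullCoset (hullUnit x) N = x :=
  (pure_le_zeroSetFilter x (eventually_mk_eq_hullCoset (hullUnit x) N)).symm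

theorem exists_mk_eq_hullCoset (z : realHull G) (N : SmKernel G) :
    ∃ b : G, (b : G ⧸ N.1) = hullCoset z N :=
  (eventually_mk_eq_hullCoset z N).exists

/-- A continuous function that is constant on the cosets of `N` is determined by cosets. -/
theorem apply_eq_apply_hullUnit {u : realHull G → ℝ} (hu : Continuous u) {N : SmKernel G}
    (hN : ∀ x y, x⁻¹ * y ∈ N.1 → u (hullUnit x) = u (hullUnit y)) {w : realHull G} {b : G}
    (hb : (b : G ⧸ N.1) = hullCoset w N) : u w = u (hullUnit b) := by
  obtain ⟨x, hx1, hx2⟩ := ((eventually_eq_apply w hu).and (eventually_mk_eq_hullCoset w N)).exists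
  rw [← hx1]
  exact hN x b (QuotientGroup.eq.1 (hx2.trans hb.symm))

/-- The compatible families of cosets. -/
def kernelThreads (G : Type u) [Group G] [TopologicalSpace G] :
    Subgroup (∀ N : SmKernel G, G ⧸ N.1) where
  carrier := {c | ∀ N M, ∃ g : G, (g : G ⧸ N.1) = c N ∧ (g : G ⧸ M.1) = c M}
  mul_mem' := fun {c d} hc hd N M => by
    obtain ⟨g, hgN, hgM⟩ := hc N M
    obtain ⟨k, hkN, hkM⟩ := hd N M
    exact ⟨g * k, by simp [hgN, hkN], by simp [hgM, hkM]⟩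
  one_mem' := fun N M => ⟨1, rfl, rfl⟩
  inv_mem' := fun {c} hc N M => by
    obtain ⟨g, hgN, hgM⟩ := hc N M
    exact ⟨g⁻¹, by simp [hgN], by simp [hgM]⟩

theorem hullCoset_mem_kernelThreads (z : realHull G) : hullCoset z ∈ kernelThreads G :=
  fun N M => ((eventually_mk_eq_hullCoset z N).and (eventually_mk_eq_hullCoset z M)).exists

/-- Each continuous function on `βG` is constant on the cosets of some kernel within `G`, so its
value at a hull point depends only on the chosen coset. -/
theorem hullCoset_injective (hG : IsSimplySmFactorizable G) :
    Function.Injective (hullCoset : realHull G → _) := fun z w h => by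
  refine Subtype.ext (isClosedEmbedding_eval_stoneCech.injective (funext fun g => ?_))
  obtain ⟨N, hN, hgN⟩ := hG.exists_smKernel (g.continuous.comp continuous_stoneCechUnit)
  have hc : Continuous fun z : realHull G => g z := by fun_prop
  obtain ⟨b, hb⟩ := exists_mk_eq_hullCoset z ⟨N, hN⟩
  exact (apply_eq_apply_hullUnit (N := ⟨N, hN⟩) hc hgN hb).trans
    (apply_eq_apply_hullUnit (N := ⟨N, hN⟩) hc hgN (hb.trans (congr_fun h _))).symm

theorem exists_hullCoset_eq (hG : IsSimplySmFactorizable G) {c : ∀ N : SmKernel G, G ⧸ N.1}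
    (hc : c ∈ kernelThreads G) : ∃ z : realHull G, hullCoset z = c := by
  let F : Filter G := ⨅ N : SmKernel G, 𝓟 {x : G | (x : G ⧸ N.1) = c N}
  have hmono : ∀ N M : SmKernel G, N.1 ≤ M.1 → ∀ x : G, (x : G ⧸ N.1) = c N →
      (x : G ⧸ M.1) = c M := fun N M hNM x hx => by
    obtain ⟨g, hgN, hgM⟩ := hc N M
    rw [← hgM]
    exact QuotientGroup.eq.2 (hNM (QuotientGroup.eq.1 (hx.trans hgN.symm)))
  have : Nonempty (SmKernel G) :=
    let ⟨N, hN, _⟩ := hG.exists_smKernel (f := fun _ => 0) continuous_const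
    ⟨⟨N, hN⟩⟩
  have hF : F.NeBot := by
    refine iInf_neBot_of_directed' (fun N M => ⟨⟨N.1 ⊓ M.1, N.2.inf M.2⟩, ?_, ?_⟩) fun N => ?_
    · exact principal_mono.2 (hmono ⟨N.1 ⊓ M.1, N.2.inf M.2⟩ N inf_le_left)
    · exact principal_mono.2 (hmono ⟨N.1 ⊓ M.1, N.2.inf M.2⟩ M inf_le_right)
    · obtain ⟨g, hg, -⟩ := hc N N
      exact principal_neBot_iff.2 ⟨g, hg⟩
  -- The cosets `c N` generate a proper filter, and compactness of `βG` supplies the candidate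
  -- point.
  obtain ⟨z, hz⟩ := exists_clusterPt_of_compactSpace (F.map (stoneCechUnit : G → StoneCech G))
  have hval : ∀ (g : C(StoneCech G, ℝ)) (N : SmKernel G) (b : G), (b : G ⧸ N.1) = c N →
      (∀ x y, x⁻¹ * y ∈ N.1 → g (stoneCechUnit x) = g (stoneCechUnit y)) →
      g z = g (stoneCechUnit b) := by
    intro g N b hb hg
    have hcl : IsClosed {y | g y = g (stoneCechUnit b)} :=
      isClosed_eq g.continuous continuous_const
    refine hcl.closure_subset (hz.mem_closure_of_mem _ (mem_map.2 ?_))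
    refine mem_iInf_of_mem N (mem_principal.2 fun x hx => ?_)
    exact hg x b (QuotientGroup.eq.1 (Eq.trans hx hb.symm))
  have hzG : z ∈ realHull G := by
    -- A function `g` vanishing at `z` factors through some kernel, hence vanishes at a
    -- representative in `G`; so `z` is in the hull.
    refine forall_mem_nonempty_iff_neBot.1 fun A ⟨g, hgz, hgA⟩ => ?_
    obtain ⟨N, hN, hgN⟩ := hG.exists_smKernel (g.continuous.comp continuous_stoneCechUnit)
    obtain ⟨b, hb, -⟩ := hc ⟨N, hN⟩ ⟨N, hN⟩
    exact ⟨b, hgA b ((hval g ⟨N, hN⟩ b hb hgN).symm.trans hgz)⟩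
  refine ⟨⟨z, hzG⟩, funext fun N => ?_⟩
  obtain ⟨f, hf, hfN⟩ := N.2.exists_continuous
  obtain ⟨b, hb, -⟩ := hc N N
  have h : ∀ n, ∀ᶠ x in zeroSetFilter z, f n x = f n b := fun n => by
    obtain ⟨g, hg⟩ := exists_extension_of_mem_Icc (Real.continuous_arctan.comp (hf n))
      (a := -(Real.pi / 2)) (b := Real.pi / 2)
      fun x => ⟨(Real.arctan_mem_Ioo _).1.le, (Real.arctan_mem_Ioo _).2.le⟩
    have hgz := hval g N b hb fun x y hxy => by
      simp only [hg, Function.comp_apply, (hfN x y).1 hxy n]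
    filter_upwards [eventually_zeroSetFilter_eq g z] with x hx
    rw [hgz, hg, hg] at hx
    exact Real.arctan_injective hx
  have : (zeroSetFilter z).NeBot := hzG
  obtain ⟨x, hx1, hx2⟩ := ((eventually_countable_forall.2 h).and
    (eventually_mk_eq_hullCoset ⟨z, hzG⟩ N)).exists
  rw [← hx2, ← hb]
  exact QuotientGroup.eq.2 ((hfN x b).2 hx1)

/-- The hull is the group of compatible families of cosets. -/
noncomputable def hullEquiv (hG : IsSimplySmFactorizable G) : realHull G ≃ kernelThreads G :=
  Equiv.ofBijective (fun z => ⟨hullCoset z, hullCoset_mem_kernelThreads z⟩)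
    ⟨fun _ _ h => hullCoset_injective hG (congr_arg Subtype.val h), fun c =>
      (exists_hullCoset_eq hG c.2).imp fun _ h => Subtype.ext h⟩

theorem exists_group_realHull (hG : IsSimplySmFactorizable G) :
    ∃ _ : Group (realHull G), ∀ (z w : realHull G) (N : SmKernel G),
      hullCoset (z * w) N = hullCoset z N * hullCoset w N := by
  let _ := (hullEquiv hG).group
  refine ⟨inferInstance, fun z w N => ?_⟩
  have h : hullEquiv hG (z * w) = hullEquiv hG z * hullEquiv hG w :=
    (hullEquiv hG).apply_symm_apply _
  exact congr_fun (congr_arg Subtype.val h) N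

variable [Group (realHull G)]

theorem hullUnit_mul (hG : IsSimplySmFactorizable G)
    (hmul : ∀ (z w : realHull G) (N : SmKernel G),
      hullCoset (z * w) N = hullCoset z N * hullCoset w N) (x y : G) :
    (hullUnit (x * y) : realHull G) = hullUnit x * hullUnit y :=
  hullCoset_injective hG (funext fun N => by simp [hmul, hullCoset_hullUnit])

theorem exists_continuousMap_bounds {Y : Type*} [TopologicalSpace Y] [CompactSpace Y]
    (g : C(Y, ℝ)) : ∃ a b, ∀ y, g y ∈ Icc a b := by
  obtain ⟨a, ha⟩ := (isCompact_range g.continuous).bddBelow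
  obtain ⟨b, hb⟩ := (isCompact_range g.continuous).bddAbove
  exact ⟨a, b, fun y => ⟨ha ⟨y, rfl⟩, hb ⟨y, rfl⟩⟩⟩

theorem isSimplySmFactorizable_realHull (hG : IsSimplySmFactorizable G)
    (hmul : ∀ (z w : realHull G) (N : SmKernel G),
      hullCoset (z * w) N = hullCoset z N * hullCoset w N) :
    IsSimplySmFactorizable (realHull G) := by
  rintro _ ⟨u, hu, rfl⟩
  obtain ⟨N, hN, hNu⟩ := hG.exists_smKernel (hu.comp continuous_hullUnit)
  obtain ⟨H, _, _, _, _, _, p, hp, hpN⟩ := id hN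
  subst hpN
  let N : SmKernel G := ⟨p.ker, hN⟩
  let q : realHull G →* H :=
    (QuotientGroup.kerLift p).comp (MonoidHom.mk' (fun z => hullCoset z N) fun z w => hmul z w N)
  have hq : ∀ (w : realHull G) (b : G), (b : G ⧸ N.1) = hullCoset w N → q w = p b :=
    fun w b hb => congr_arg (QuotientGroup.kerLift p) hb.symm
  have hqc : Continuous q := by
    let _ := TopologicalSpace.metrizableSpaceMetric H
    refine continuous_iff_continuousAt.2 fun z => Metric.tendsto_nhds.2 fun ε hε => ?_
    -- The truncated distance to `q z` extends continuously to `βG`. On the hull the extension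
    -- equals the truncated distance between `q w` and `q z`, since both depend only on the coset of
    -- `w`.
    obtain ⟨k, hk⟩ := exists_extension_of_mem_Icc (f := fun x => min (dist (p x) (q z)) 1)
      (a := 0) (b := 1) ((hp.dist continuous_const).min continuous_const)
      fun x => ⟨le_min dist_nonneg zero_le_one, min_le_right _ _⟩
    have hkc : Continuous fun w : realHull G => k w := by fun_prop
    have hkq : ∀ w : realHull G, k w = min (dist (q w) (q z)) 1 := fun w => by
      obtain ⟨b, hb⟩ := exists_mk_eq_hullCoset w N
      have h1 : k w = k (stoneCechUnit b) :=
        apply_eq_apply_hullUnit (N := N) hkc (fun x y hxy => by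
          change k (stoneCechUnit x) = k (stoneCechUnit y)
          have hxy' : x⁻¹ * y ∈ p.ker := hxy
          rw [MonoidHom.mem_ker, map_mul, map_inv, inv_mul_eq_one] at hxy'
          rw [hk, hk, hxy']) hb
      rw [h1, hk, hq w b hb]
    have hev : ∀ᶠ w : realHull G in 𝓝 z, k w < min ε 1 := by
      refine hkc.continuousAt.eventually_lt continuousAt_const ?_
      simp [hkq, hε]
    filter_upwards [hev] with w hw
    rw [hkq] at hw
    rcases min_lt_iff.1 (hw.trans_le (min_le_right _ _)) with h | h
    · rw [min_eq_left h.le] at hw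
      exact hw.trans_le (min_le_left _ _)
    · exact (lt_irrefl _ h).elim
  -- A kernel presentation does not require `p` to be onto, so the target is cut down to the range
  -- of `q`.
  have := Submonoid.continuousMul q.range.toSubmonoid
  have h2 : SecondCountableTopology q.range :=
    TopologicalSpace.Subtype.secondCountableTopology (q.range : Set H)
  have hm : TopologicalSpace.MetrizableSpace q.range := IsEmbedding.subtypeVal.metrizableSpace
  refine ⟨q.range, inferInstance, instTopologicalSpaceSubtype, this, inferInstance, hm,
    q.rangeRestrict, hqc.subtype_mk _, q.rangeRestrict_surjective, ?_⟩
  refine Subset.antisymm ?_ (subset_preimage_image _ _)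
  rintro w ⟨w', hw', hww'⟩
  have h1 : q w' = q w := congr_arg Subtype.val hww'
  obtain ⟨b, hb⟩ := exists_mk_eq_hullCoset w N
  have h2 : hullCoset w' N = hullCoset w N := QuotientGroup.kerLift_injective p h1
  have h3 := apply_eq_apply_hullUnit (N := N) hu hNu hb
  have h4 := apply_eq_apply_hullUnit (N := N) hu hNu (hb.trans h2.symm)
  exact fun h => hw' (h4.trans (h3.symm.trans h))

variable [ContinuousMul G]

/-- For a test function `g` adapted to `N` and a representative `a` of the `N`-coset of `z`, the map
`w ↦ g (z * w)` is the restriction of the extension to `βG` of `x ↦ g (a * x)`. -/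
theorem continuous_mul_left_realHull (hG : IsSimplySmFactorizable G)
    (hmul : ∀ (z w : realHull G) (N : SmKernel G),
      hullCoset (z * w) N = hullCoset z N * hullCoset w N) (z : realHull G) :
    Continuous fun w => z * w := by
  refine continuous_iff_continuousAt.2 fun w₀ => tendsto_nhds_realHull_iff.2 fun g => ?_
  suffices h : Continuous fun w : realHull G => g ↑(z * w) from h.continuousAt
  obtain ⟨N, hN, hgN⟩ := hG.exists_smKernel (g.continuous.comp continuous_stoneCechUnit)
  obtain ⟨a, ha⟩ := exists_mk_eq_hullCoset z ⟨N, hN⟩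
  obtain ⟨l, r, hlr⟩ := exists_continuousMap_bounds g
  obtain ⟨k, hk⟩ := exists_extension_of_mem_Icc (f := fun x => g (stoneCechUnit (a * x)))
    (g.continuous.comp (continuous_stoneCechUnit.comp (continuous_const_mul a))) fun x => hlr _
  have hkc : Continuous fun w : realHull G => k w := by fun_prop
  refine hkc.congr fun w => ?_
  obtain ⟨b, hb⟩ := exists_mk_eq_hullCoset w ⟨N, hN⟩
  have h1 : k w = k (stoneCechUnit b) :=
    apply_eq_apply_hullUnit (N := ⟨N, hN⟩) hkc (fun x y hxy => by
      change k (stoneCechUnit x) = k (stoneCechUnit y)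
      rw [hk, hk]
      exact hgN _ _ (by simpa [mul_assoc] using hxy)) hb
  have h2 : g ↑(z * w) = g (stoneCechUnit (a * b)) :=
    apply_eq_apply_hullUnit (u := fun w => g w) (N := ⟨N, hN⟩) (by fun_prop) hgN
      (by rw [hmul, ← ha, ← hb]; rfl)
  rw [h1, h2, hk]

theorem continuous_mul_right_realHull (hG : IsSimplySmFactorizable G)
    (hmul : ∀ (z w : realHull G) (N : SmKernel G),
      hullCoset (z * w) N = hullCoset z N * hullCoset w N) (z : realHull G) :
    Continuous fun w => w * z := by
  refine continuous_iff_continuousAt.2 fun w₀ => tendsto_nhds_realHull_iff.2 fun g => ?_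
  suffices h : Continuous fun w : realHull G => g ↑(w * z) from h.continuousAt
  obtain ⟨N, hN, hgN⟩ := hG.exists_smKernel (g.continuous.comp continuous_stoneCechUnit)
  obtain ⟨a, ha⟩ := exists_mk_eq_hullCoset z ⟨N, hN⟩
  obtain ⟨l, r, hlr⟩ := exists_continuousMap_bounds g
  obtain ⟨k, hk⟩ := exists_extension_of_mem_Icc (f := fun x => g (stoneCechUnit (x * a)))
    (g.continuous.comp (continuous_stoneCechUnit.comp (continuous_mul_const a))) fun x => hlr _
  have hkc : Continuous fun w : realHull G => k w := by fun_prop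
  refine hkc.congr fun w => ?_
  obtain ⟨b, hb⟩ := exists_mk_eq_hullCoset w ⟨N, hN⟩
  have h1 : k w = k (stoneCechUnit b) :=
    apply_eq_apply_hullUnit (N := ⟨N, hN⟩) hkc (fun x y hxy => by
      change k (stoneCechUnit x) = k (stoneCechUnit y)
      rw [hk, hk]
      exact hgN _ _ (by simpa [mul_assoc] using hN.normal.conj_mem _ hxy a⁻¹)) hb
  have h2 : g ↑(w * z) = g (stoneCechUnit (b * a)) :=
    apply_eq_apply_hullUnit (u := fun w => g w) (N := ⟨N, hN⟩) (by fun_prop) hgN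
      (by rw [hmul, ← ha, ← hb]; rfl)
  rw [h1, h2, hk]

/-- A function `f` that is 0 at 1 and 1 off `V` extends to `βG` as `k`. Modulo a kernel adapted to
both `f` and `g`, points with `k < 1` have representatives in `V`, so the estimate on `V * V` in `G`
carries over. -/
theorem tendsto_mul_realHull [T35Space G] (hG : IsSimplySmFactorizable G)
    (hmul : ∀ (z w : realHull G) (N : SmKernel G),
      hullCoset (z * w) N = hullCoset z N * hullCoset w N) :
    Tendsto (Function.uncurry ((· * ·) : realHull G → realHull G → realHull G))
      (𝓝 1 ×ˢ 𝓝 1) (𝓝 1) := by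
  have hone : (hullUnit (1 : G) : realHull G) = 1 := by
    simpa using hullUnit_mul hG hmul 1 1
  refine tendsto_nhds_realHull_iff.2 fun g => Metric.tendsto_nhds.2 fun ε hε => ?_
  have hgc : Continuous fun x : G => g (stoneCechUnit x) :=
    g.continuous.comp continuous_stoneCechUnit
  obtain ⟨V, hV, hV1, hVg⟩ := exists_open_nhds_one_mul_subset
    (hgc.continuousAt.preimage_mem_nhds (Metric.ball_mem_nhds (g (stoneCechUnit 1)) hε))
  obtain ⟨f, hf, h0, h1⟩ := CompletelyRegularSpace.completely_regular_isOpen (1 : G) V hV hV1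
  have hfc : Continuous fun x => (f x : ℝ) := continuous_subtype_val.comp hf
  obtain ⟨k, hk⟩ := exists_extension_of_mem_Icc hfc fun x => (f x).2
  obtain ⟨N, hN, hgN⟩ := hG.exists_smKernel hgc
  obtain ⟨M, hM, hfM⟩ := hG.exists_smKernel hfc
  have hkc : Continuous fun w : realHull G => k w := by fun_prop
  have hrep : ∀ (w : realHull G) (b : G), (b : G ⧸ (N ⊓ M)) = hullCoset w ⟨N ⊓ M, hN.inf hM⟩ →
      k w < 1 → b ∈ V := fun w b hb hw => by
    have h2 : k w = k (stoneCechUnit b) :=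
      apply_eq_apply_hullUnit (N := ⟨N ⊓ M, hN.inf hM⟩) hkc (fun x y hxy => by
        change k (stoneCechUnit x) = k (stoneCechUnit y)
        rw [hk, hk]
        exact hfM x y hxy.2) hb
    by_contra hbV
    have h3 : f b = 1 := h1 hbV
    simp [h2, hk, h3] at hw
  have hev : ∀ᶠ w : realHull G in 𝓝 1, k w < 1 := by
    refine hkc.continuousAt.eventually_lt continuousAt_const ?_
    rw [← hone]
    change k (stoneCechUnit 1) < 1
    simp [hk, h0]
  filter_upwards [prod_mem_prod hev hev] with ⟨z, w⟩ ⟨hz, hw⟩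
  obtain ⟨a, ha⟩ := exists_mk_eq_hullCoset z ⟨N ⊓ M, hN.inf hM⟩
  obtain ⟨b, hb⟩ := exists_mk_eq_hullCoset w ⟨N ⊓ M, hN.inf hM⟩
  have h2 : g ↑(z * w) = g (stoneCechUnit (a * b)) :=
    apply_eq_apply_hullUnit (u := fun w => g w) (N := ⟨N ⊓ M, hN.inf hM⟩) (by fun_prop)
      (fun x y hxy => hgN x y hxy.1) (by rw [hmul, ← ha, ← hb]; rfl)
  have h3 : a * b ∈ V * V := Set.mul_mem_mul (hrep z a ha hz) (hrep w b hb hw)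
  rw [← hone]
  change dist (g ↑(z * w)) (g (stoneCechUnit 1)) < ε
  rw [h2]
  exact hVg h3

theorem continuousMul_realHull [T35Space G] (hG : IsSimplySmFactorizable G)
    (hmul : ∀ (z w : realHull G) (N : SmKernel G),
      hullCoset (z * w) N = hullCoset z N * hullCoset w N) : ContinuousMul (realHull G) := by
  refine .of_nhds_one (tendsto_mul_realHull hG hmul) (fun z => ?_) fun z => ?_
  · let e : realHull G ≃ₜ realHull G :=
      { Equiv.mulLeft z with
        continuous_toFun := continuous_mul_left_realHull hG hmul z
        continuous_invFun := continuous_mul_left_realHull hG hmul z⁻¹ }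
    have h := e.map_nhds_eq 1
    rw [show e 1 = z from mul_one z] at h
    exact h.symm
  · let e : realHull G ≃ₜ realHull G :=
      { Equiv.mulRight z with
        continuous_toFun := continuous_mul_right_realHull hG hmul z
        continuous_invFun := continuous_mul_right_realHull hG hmul z⁻¹ }
    have h := e.map_nhds_eq 1
    rw [show e 1 = z from one_mul z] at h
    exact h.symm

end HullGroup

/-! ### The theorem. -/

theorem lemma4p4 (G : Type u) [Group G] [TopologicalSpace G] [ContinuousMul G] [T3Space G]
    (hG : IsSimplySmFactorizable G) :
    narrownessIndex (AssociatedGroup G) ≤ 𝔠 ∧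
    cellularity G ≤ cellularity (AssociatedGroup G) ∧
    cellularity (AssociatedGroup G) ≤ 2 ^ (𝔠 : Cardinal.{u}) ∧
    dieudonneCompletion G = hewittNachbin G ∧
    ∃ (_ : Group (dieudonneCompletion G)) (_ : ContinuousMul (dieudonneCompletion G))
      (j : G →* dieudonneCompletion G),
      (∀ g : G, (j g : StoneCech G) = stoneCechUnit g) ∧
      IsEmbedding j ∧ DenseRange j ∧
      IsSimplySmFactorizable (dieudonneCompletion G) := by
  have : T35Space G := t35Space_of_t3Space
  refine ⟨hG.narrownessIndex_associatedGroup_le, cellularity_le_associatedGroup,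
    hG.cellularity_associatedGroup_le, ?_, ?_⟩
  · rw [dieudonneCompletion_eq_realHull hG.hasSmallCellularity,
      hewittNachbin_eq_realHull hG.hasSmallCellularity]
  rw [dieudonneCompletion_eq_realHull hG.hasSmallCellularity]
  obtain ⟨_, hmul⟩ := exists_group_realHull hG
  refine ⟨inferInstance, continuousMul_realHull hG hmul,
    MonoidHom.mk' hullUnit (hullUnit_mul hG hmul), fun _ => rfl, ?_, ?_,
    isSimplySmFactorizable_realHull hG hmul⟩
  · exact IsEmbedding.of_comp continuous_hullUnit continuous_subtype_val isEmbedding_stoneCechUnit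
  · refine (Subtype.dense_iff (t := range hullUnit)).2 fun z _ => ?_
    rw [← range_comp]
    exact denseRange_stoneCechUnit z
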